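/- Identify a deterministic two-party communication protocol with a binary tree whose internal nodes are labelled by a player and by the bit that this player sends there (a function of that player's input only) and whose leaves are labelled by outputs; its cost is the height of the tree, and $D(f)$ denotes the least cost of such a protocol that computes $f$ on all pairs of inputs. There is an absolute constant $C>0$ such that for all integers $d\ge 1$ and $n\ge 0$ the following hold. 1. (Convex Set Disjointness.) Let $U\subseteq\mathbb{R}^d$ with $|U|=n$, and let $\mathrm{CSD}_U\colon 2^U\times 2^U\to\{0,1\}$ be the function with $\mathrm{CSD}_U(X,Y)=0$ if $\mathrm{conv}(X)\cap\mathrm{conv}(Y)\neq\emptyset$ and $\mathrm{CSD}_U(X,Y)=1$ otherwise. Then $$D(\mathrm{CSD}_U)\le C\,d^2\,\log(d+1)\,\log(n+1).$$ 2. (Two-party LP feasibility.) Let $W\subseteq\mathbb{R}^d\times\mathbb{R}$ with $|W|=n$, where $(a,b)\in W$ stands for the linear constraint $\langle a,x\rangle\le b$ in the unknown $x\in\mathbb{R}^d$, and let $\mathrm{LP}_W\colon 2^W\times 2^W\to\{0,1\}$ be the function with $\mathrm{LP}_W(A,B)=1$ if some $x\in\mathbb{R}^d$ satisfies all constraints in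 $A\cup B$, and $\mathrm{LP}_W(A,B)=0$ otherwise. Then $$D(\mathrm{LP}_W)\le C\,d^2\,\log(d+1)\,\log(n+1).$$ In particular, for $d,n\ge 2$ both complexities are $O(d^2\log d\,\log n)$ with an absolute implied constant. -/

import Mathlib

/-- A deterministic two-party communication protocol with Alice's inputs in `𝒳`, Bob's inputs in
`𝒴` and outputs in `Z`: a binary tree in which every internal node belongs to one of the two
players and is labelled by the bit which that player sends there (a function of that player's
input alone), and every leaf is labelled by an output. If the bit is `false`, the protocol
continues in the first subtree, otherwise in the second one. -/
inductive Protocol (𝒳 𝒴 Z : Type) : Type where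
  | leaf (z : Z) : Protocol 𝒳 𝒴 Z
  | alice (a : 𝒳 → Bool) (P₀ P₁ : Protocol 𝒳 𝒴 Z) : Protocol 𝒳 𝒴 Z
  | bob (b : 𝒴 → Bool) (P₀ P₁ : Protocol 𝒳 𝒴 Z) : Protocol 𝒳 𝒴 Z

/-- The output of the protocol on the input pair `(x, y)`: the label of the leaf it reaches. -/
def Protocol.eval {𝒳 𝒴 Z : Type} : Protocol 𝒳 𝒴 Z → 𝒳 → 𝒴 → Z
  | .leaf z, _, _ => z
  | .alice a P₀ P₁, x, y => if a x = true then P₁.eval x y else P₀.eval x y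
  | .bob b P₀ P₁, x, y => if b y = true then P₁.eval x y else P₀.eval x y

/-- The cost of the protocol: the height of the tree, i.e. the largest number of bits exchanged. -/
def Protocol.cost {𝒳 𝒴 Z : Type} : Protocol 𝒳 𝒴 Z → ℕ
  | .leaf _ => 0
  | .alice _ P₀ P₁ => max P₀.cost P₁.cost + 1
  | .bob _ P₀ P₁ => max P₀.cost P₁.cost + 1

/-- The protocol computes `f`. -/
def Protocol.Computes {𝒳 𝒴 Z : Type} (P : Protocol 𝒳 𝒴 Z) (f : 𝒳 → 𝒴 → Z) : Prop :=
  ∀ x y, P.eval x y = f x y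

/-- The deterministic communication complexity `D(f)`: the least cost of a deterministic protocol
that computes `f` (and `⊤` if there is none). -/
noncomputable def detCC {𝒳 𝒴 Z : Type} (f : 𝒳 → 𝒴 → Z) : ℕ∞ :=
  ⨅ (P : Protocol 𝒳 𝒴 Z) (_ : P.Computes f), (P.cost : ℕ∞)

open Classical in
/-- Convex Set Disjointness on the finite domain `U ⊆ ℝ^d`: Alice's input is `X ⊆ U`, Bob's input
is `Y ⊆ U`, and the value is `0` (`false`) if the convex hulls of `X` and `Y` intersect, and `1`
(`true`) otherwise. -/
noncomputable def CSD {d : ℕ} (U : Finset (EuclideanSpace ℝ (Fin d))) (X Y : Set U) : Bool :=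
  if (convexHull ℝ ((fun u : U => (u : EuclideanSpace ℝ (Fin d))) '' X) ∩
      convexHull ℝ ((fun u : U => (u : EuclideanSpace ℝ (Fin d))) '' Y)).Nonempty
  then false else true

open Classical in
/-- Two-party LP feasibility over the finite domain `W` of linear constraints in `d` real unknowns,
where the pair `(a, b)` stands for the constraint `⟨a, x⟩ ≤ b`: Alice's input is a set `A ⊆ W` of
constraints, Bob's input is a set `B ⊆ W` of constraints, and the value is `1` (`true`) if some
`x ∈ ℝ^d` satisfies all the constraints in `A ∪ B`, and `0` (`false`) otherwise. -/
noncomputable def LPFeas {d : ℕ} (W : Finset (EuclideanSpace ℝ (Fin d) × ℝ)) (A B : Set W) : Bool :=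
  if ∃ x : EuclideanSpace ℝ (Fin d), ∀ c ∈ A ∪ B, inner ℝ c.1.1 x ≤ c.1.2
  then true else false

/-! Both problems reduce to testing disjointness of two finite sets of candidate points. A set V
with n^O(d) points is fixed in advance such that, whenever the convex sets H(X) and H(Y) held by the
players meet, they meet in a point of V (`exists_candidates_convexHull` via Carathéodory,
`exists_candidates_polyhedron` via minimal faces). With A = V ∩ H(X) and B = V ∩ H(Y), disjointness
of A and B then forces disjointness of their convex hulls.

Such pairs are handled by shrinking V (`exists_protocol_of_subset`). If the hulls are disjoint, a
hyperplane separates them strictly, so one player's points lie in a halfspace with at most half of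
V. The halfspace cannot be named cheaply, but a container of it with at most 3/4 of V can, in O(d
log d) bits (`exists_containers`). If neither player can name one, A and B meet. After O(d log n)
rounds V is empty.

The number of containers must not depend on V. A random sample of O(d²) points of V is dualised to
hyperplanes, whose arrangement is cut into cells each described by O(d) sampled forms. By a union
bound over the descriptions (`exists_sample`), some sample makes every cell avoided by the sampled
hyperplanes be crossed by at most a quarter of the hyperplanes of V. The container of a cell
consists of the points whose form is negative somewhere on it. -/

/-! ### Cells of a vertical decomposition -/

/-- Elimination of the first variable from the linear forms `g`: a multiple of `g p.1` or of `g p.2`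
(according to the sign of the first coefficient) is subtracted. -/
noncomputable def eliminate {ι : Type} {k : ℕ} (g : ι → Fin (k + 1) → ℝ) (p : ι × ι) (i : ι) :
    Fin k → ℝ := fun t =>
  g i t.succ - g i 0 / g (if 0 < g i 0 then p.1 else p.2) 0 *
    g (if 0 < g i 0 then p.1 else p.2) t.succ

theorem eliminate_dotProduct {ι : Type} {k : ℕ} (g : ι → Fin (k + 1) → ℝ) (p : ι × ι) (i : ι)
    (x : Fin (k + 1) → ℝ) (h : g i 0 = 0 ∨ g (if 0 < g i 0 then p.1 else p.2) 0 ≠ 0) :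
    eliminate g p i ⬝ᵥ Fin.tail x = g i ⬝ᵥ x -
      g i 0 / g (if 0 < g i 0 then p.1 else p.2) 0 *
        (g (if 0 < g i 0 then p.1 else p.2) ⬝ᵥ x) := by
  unfold eliminate
  generalize (if 0 < g i 0 then p.1 else p.2) = j at h ⊢
  simp only [dotProduct, Fin.sum_univ_succ, Fin.tail, sub_mul, Finset.sum_sub_distrib, mul_add,
    Finset.mul_sum, mul_assoc]
  rcases h with h | h
  · simp [h]
  · field_simp
    ring

/-- The cell of the vertical decomposition that is described by the pairs `c` of linear forms. -/
def decompCell {ι : Type} : {k : ℕ} → (ι → Fin k → ℝ) → (Fin k → ι × ι) → Set (Fin k → ℝ)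
  | 0, _, _ => Set.univ
  | _ + 1, g, c => {x | 0 ≤ g (c 0).1 ⬝ᵥ x ∧ 0 ≤ g (c 0).2 ⬝ᵥ x ∧
      Fin.tail x ∈ decompCell (eliminate g (c 0)) (Fin.tail c)}

/-- Eliminating from a form involves only that form and the two named pivots, so the cell never sees
forms outside its description. Hence a cell depends on at most 2k sample entries, which the sampling
argument needs. -/
theorem decompCell_congr {ι : Type} {k : ℕ} (g g' : ι → Fin k → ℝ) (c : Fin k → ι × ι)
    (h₁ : ∀ t, g (c t).1 = g' (c t).1) (h₂ : ∀ t, g (c t).2 = g' (c t).2) :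
    decompCell g c = decompCell g' c := by
  induction k with
  | zero => rfl
  | succ k ih =>
    have key : ∀ i, g i = g' i → eliminate g (c 0) i = eliminate g' (c 0) i := by
      intro i hi
      unfold eliminate
      funext t
      rw [hi]
      split_ifs
      · rw [h₁ 0]
      · rw [h₂ 0]
    have := ih (eliminate g (c 0)) (eliminate g' (c 0)) (Fin.tail c)
      (fun t => key _ (h₁ t.succ)) (fun t => key _ (h₂ t.succ))
    simp only [decompCell, this, h₁ 0, h₂ 0]

/-- A ratio test: with first coefficients `α` and values `v` at a point, `j` is the form that
vanishes first as the first coordinate decreases. If no coefficient is positive, any member of `S`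
serves. -/
theorem exists_min_ratio {ι : Type} (S : Finset ι) (hS : S.Nonempty) (α v : ι → ℝ) :
    ∃ j ∈ S, ∀ i ∈ S, 0 < α i → 0 < α j ∧ v j / α j ≤ v i / α i := by
  classical
  by_cases h : (S.filter fun i => 0 < α i).Nonempty
  · obtain ⟨j, hj, hmin⟩ := Finset.exists_min_image _ (fun i => v i / α i) h
    rw [Finset.mem_filter] at hj
    exact ⟨j, hj.1, fun i hi hpos => ⟨hj.2, hmin i (by simp [hi, hpos])⟩⟩
  · obtain ⟨j, hj⟩ := hS
    refine ⟨j, hj, fun i hi hpos => (h ⟨i, by simp [hi, hpos]⟩).elim⟩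

/-- Every point lies in a cell, described by forms from `S`, on which no form from `S` that is
nonnegative at the point changes its sign. -/
theorem exists_decompCell {ι : Type} {k : ℕ} (S : Finset ι) (hS : S.Nonempty)
    (g : ι → Fin k → ℝ) (w : Fin k → ℝ) (hw : ∀ i ∈ S, 0 ≤ g i ⬝ᵥ w) :
    ∃ c : Fin k → ι × ι, w ∈ decompCell g c ∧ ∀ x ∈ decompCell g c, ∀ i ∈ S, 0 ≤ g i ⬝ᵥ x := by
  induction k with
  | zero => exact ⟨Fin.elim0, trivial, fun x _ i _ => by simp [dotProduct]⟩
  | succ k ih =>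
    obtain ⟨lo, hlo, hlo'⟩ := exists_min_ratio S hS (fun i => g i 0) (fun i => g i ⬝ᵥ w)
    obtain ⟨up, hup, hup'⟩ := exists_min_ratio S hS (fun i => -g i 0) (fun i => g i ⬝ᵥ w)
    -- Each form is its eliminated form plus a nonnegative multiple of `lo` or `up`. Minimality of
    -- the ratio keeps the eliminated form nonnegative at `w`; conversely, its nonnegativity on the
    -- smaller cell lifts back.
    have key : ∀ i ∈ S, ∃ j ∈ S, j = (if 0 < g i 0 then lo else up) ∧ (g i 0 = 0 ∨ g j 0 ≠ 0) ∧
        0 ≤ g i 0 / g j 0 ∧ g i 0 / g j 0 * (g j ⬝ᵥ w) ≤ g i ⬝ᵥ w := by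
      intro i hi
      rcases lt_trichotomy (g i 0) 0 with h | h | h
      · obtain ⟨h1, h2⟩ := hup' i hi (by simpa using h)
        simp only [Left.neg_pos_iff] at h1
        refine ⟨up, hup, by simp [h.le], Or.inr h1.ne, div_nonneg_of_nonpos h.le h1.le, ?_⟩
        rw [div_le_div_iff₀ (by linarith) (by linarith)] at h2
        rw [div_mul_eq_mul_div, div_le_iff_of_neg h1]
        linarith
      · exact ⟨up, hup, by simp [h], Or.inl h, by simp [h], by simpa [h] using hw i hi⟩
      · obtain ⟨h1, h2⟩ := hlo' i hi h
        refine ⟨lo, hlo, by simp [h], Or.inr h1.ne', div_nonneg h.le h1.le, ?_⟩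
        rw [div_le_div_iff₀ h1 h] at h2
        rw [div_mul_eq_mul_div, div_le_iff₀ h1]
        linarith
    obtain ⟨c, hc, hc'⟩ := ih (eliminate g (lo, up)) (Fin.tail w) (by
      intro i hi
      obtain ⟨j, -, hj, h0, -, h⟩ := key i hi
      subst hj
      rw [eliminate_dotProduct g (lo, up) i w h0]
      exact sub_nonneg.2 h)
    refine ⟨Fin.cons (lo, up) c, ⟨hw _ hlo, hw _ hup, by simpa using hc⟩, ?_⟩
    rintro x ⟨h1, h2, h3⟩ i hi
    simp only [Fin.cons_zero, Fin.tail_cons] at h1 h2 h3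
    obtain ⟨j, -, hj, h0, hq, -⟩ := key i hi
    have h4 := hc' _ h3 i hi
    subst hj
    rw [eliminate_dotProduct g (lo, up) i x h0] at h4
    have h5 : 0 ≤ g (if 0 < g i 0 then lo else up) ⬝ᵥ x := by split_ifs <;> assumption
    have := mul_nonneg hq h5
    simp only at h4
    linarith

/-! ### Samples that hit all large regions -/

/-- Fixing the entries in `J` fixes the region. If it holds over a quarter of the points, each
remaining entry has fewer than 3/4 of all values left to avoid it. -/
theorem card_missing_samples_le {α : Type} [Fintype α] [DecidableEq α] {m : ℕ}
    (J : Finset (Fin m)) (R : (Fin m → α) → Finset α)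
    (hR : ∀ s s', (∀ j ∈ J, s j = s' j) → R s = R s') (B : Finset (Fin m → α))
    (hB : ∀ s ∈ B, Fintype.card α < 4 * (R s).card ∧ ∀ j, s j ∉ R s) :
    B.card * 4 ^ (m - J.card) ≤ Fintype.card α ^ m * 3 ^ (m - J.card) := by
  classical
  rcases isEmpty_or_nonempty α with hα | ⟨⟨a₀⟩⟩
  · have : B = ∅ := by
      refine Finset.eq_empty_of_forall_notMem fun s hs => ?_
      have h := (hB s hs).1
      have h2 : (R s).card = 0 := by simp [Finset.eq_empty_of_isEmpty]
      omega
    simp [this]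
  set N := Fintype.card α
  let ext : ({j // j ∈ J} → α) → Fin m → α := fun t j => if h : j ∈ J then t ⟨j, h⟩ else a₀
  let T : Finset ({j // j ∈ J} → α) := Finset.univ.filter fun t => N < 4 * (R (ext t)).card
  let D : Finset (Σ _ : ({j // j ∈ J} → α), ({j // j ∉ J} → α)) :=
    T.sigma fun t => Fintype.piFinset fun _ => (R (ext t))ᶜ
  have hext : ∀ s, R (ext fun j => s j) = R s := fun s => hR _ _ fun j hj => by simp [ext, hj]
  have hBD : B.card ≤ D.card := by
    refine Finset.card_le_card_of_injOn (fun s => ⟨fun j => s j, fun j => s j⟩) ?_ ?_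
    · intro s hs
      obtain ⟨h1, h2⟩ := hB s hs
      simp only [D, T, Finset.coe_sigma, Set.mem_sigma_iff, Finset.mem_coe, Finset.mem_filter,
        Finset.mem_univ, true_and, Fintype.mem_piFinset, Finset.mem_compl]
      rw [hext]
      exact ⟨h1, fun j => h2 j⟩
    · intro s _ s' _ h
      simp only [Sigma.mk.injEq, heq_eq_eq] at h
      funext j
      by_cases hj : j ∈ J
      · exact congrFun h.1 ⟨j, hj⟩
      · exact congrFun h.2 ⟨j, hj⟩
  have hJ : J.card ≤ m := by simpa using J.card_le_univ
  have hcard : Fintype.card {j // j ∉ J} = m - J.card := by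
    simp [Fintype.card_subtype_compl]
  have hD : D.card * 4 ^ (m - J.card) ≤ N ^ J.card * (3 * N) ^ (m - J.card) := by
    rw [Finset.card_sigma, Finset.sum_mul]
    have : ∀ t ∈ T, (Fintype.piFinset fun _ : {j // j ∉ J} => (R (ext t))ᶜ).card *
        4 ^ (m - J.card) ≤ (3 * N) ^ (m - J.card) := by
      intro t ht
      rw [Fintype.card_piFinset, Finset.prod_const, Finset.card_univ, hcard, ← mul_pow]
      refine Nat.pow_le_pow_left ?_ _
      rw [Finset.card_compl]
      have := (Finset.mem_filter.1 ht).2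
      omega
    refine (Finset.sum_le_card_nsmul _ _ _ this).trans ?_
    rw [smul_eq_mul]
    refine Nat.mul_le_mul_right _ ?_
    refine (Finset.card_le_univ _).trans ?_
    simp [N]
  calc _ ≤ _ := Nat.mul_le_mul_right _ hBD
    _ ≤ _ := hD
    _ = N ^ (J.card + (m - J.card)) * 3 ^ (m - J.card) := by rw [mul_pow, pow_add]; ring
    _ = _ := by rw [Nat.add_sub_cancel' hJ]

/-- If every region `R i s` is determined by at most `D` entries of the sample `s`, then some sample
hits every region that contains more than a quarter of the points. -/
theorem exists_sample {α κ : Type} [Fintype α] [Nonempty α] [Fintype κ] {m D : ℕ} (hD : D ≤ m)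
    (J : κ → Finset (Fin m)) (hJ : ∀ i, (J i).card ≤ D) (R : κ → (Fin m → α) → Finset α)
    (hR : ∀ i s s', (∀ j ∈ J i, s j = s' j) → R i s = R i s')
    (hm : Fintype.card κ * 3 ^ (m - D) < 4 ^ (m - D)) :
    ∃ s : Fin m → α, ∀ i, (∀ j, s j ∉ R i s) → 4 * (R i s).card ≤ Fintype.card α := by
  classical
  by_contra! hcon
  set N := Fintype.card α
  let B : κ → Finset (Fin m → α) := fun i =>
    Finset.univ.filter fun s => N < 4 * (R i s).card ∧ ∀ j, s j ∉ R i s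
  have h1 : ∀ i, (B i).card * 4 ^ (m - D) ≤ N ^ m * 3 ^ (m - D) := by
    intro i
    have h := card_missing_samples_le (J i) (R i) (hR i) (B i) fun s hs =>
      (Finset.mem_filter.1 hs).2
    -- A region determined by fewer than `D` entries has `e` further free entries, each only
    -- improving the bound by 3/4.
    obtain ⟨e, he⟩ : ∃ e, m - (J i).card = (m - D) + e := ⟨D - (J i).card, by have := hJ i; omega⟩
    rw [he, pow_add, pow_add] at h
    have h3 : 3 ^ e ≤ 4 ^ e := Nat.pow_le_pow_left (by norm_num) e
    refine Nat.le_of_mul_le_mul_right ?_ (pow_pos (by norm_num : 0 < 4) e)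
    calc _ = (B i).card * (4 ^ (m - D) * 4 ^ e) := by ring
      _ ≤ _ := h
      _ ≤ N ^ m * (3 ^ (m - D) * 4 ^ e) := by gcongr
      _ = _ := by ring
  have h2 : N ^ m ≤ ∑ i, (B i).card := by
    have : (Finset.univ : Finset (Fin m → α)) ⊆ Finset.univ.biUnion B := by
      intro s _
      obtain ⟨i, hi, hi'⟩ := hcon s
      exact Finset.mem_biUnion.2 ⟨i, Finset.mem_univ _, by simp [B, hi, hi', N]⟩
    calc N ^ m = (Finset.univ : Finset (Fin m → α)).card := by simp [N]
      _ ≤ _ := Finset.card_le_card this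
      _ ≤ _ := Finset.card_biUnion_le
  have h3 : N ^ m * 4 ^ (m - D) ≤ N ^ m * (Fintype.card κ * 3 ^ (m - D)) := by
    calc _ ≤ (∑ i, (B i).card) * 4 ^ (m - D) := Nat.mul_le_mul_right _ h2
      _ = ∑ i, (B i).card * 4 ^ (m - D) := Finset.sum_mul _ _ _
      _ ≤ ∑ _i : κ, N ^ m * 3 ^ (m - D) := Finset.sum_le_sum fun i _ => h1 i
      _ = _ := by simp; ring
  have hN : 0 < N ^ m := pow_pos Fintype.card_pos _
  exact absurd (Nat.le_of_mul_le_mul_left h3 hN) (by omega)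

/-! ### Halfspace containers -/

/-- With m = 64k² sample points and both signs there are (2m)^(2k) cell descriptions. The first
bound counts the bits naming one; the second is the union bound, which rests on 2·3³ < 4³. -/
theorem container_numerics (k ℓ : ℕ) (hk : 1 ≤ k) (hℓ : k ≤ 2 ^ ℓ) (hℓk : ℓ ≤ k) :
    (64 * k ^ 2 * 2) ^ (2 * k) ≤ 2 ^ ((14 + 4 * ℓ) * k) ∧
      (64 * k ^ 2 * 2) ^ (2 * k) * 3 ^ (64 * k ^ 2 - 2 * k) < 4 ^ (64 * k ^ 2 - 2 * k) := by
  have h1 : (64 * k ^ 2 * 2) ^ (2 * k) ≤ 2 ^ ((14 + 4 * ℓ) * k) := by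
    calc (64 * k ^ 2 * 2) ^ (2 * k) ≤ (64 * (2 ^ ℓ) ^ 2 * 2) ^ (2 * k) := by gcongr
      _ = (2 ^ (7 + ℓ * 2)) ^ (2 * k) := by
        rw [← pow_mul, pow_add]; norm_num; ring_nf
      _ = _ := by rw [← pow_mul]; congr 1; ring
  refine ⟨h1, ?_⟩
  have hkk : k ≤ k ^ 2 := Nat.le_self_pow (by norm_num) k
  obtain ⟨r, hr⟩ : ∃ r, 64 * k ^ 2 - 2 * k = 3 * (18 * k ^ 2) + (r + 1) :=
    ⟨64 * k ^ 2 - 2 * k - 3 * (18 * k ^ 2) - 1, by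
      have : 1 ≤ k ^ 2 := Nat.one_le_pow _ _ hk
      omega⟩
  have h2 : (14 + 4 * ℓ) * k ≤ 18 * k ^ 2 := by nlinarith
  calc (64 * k ^ 2 * 2) ^ (2 * k) * 3 ^ (64 * k ^ 2 - 2 * k)
      ≤ 2 ^ (18 * k ^ 2) * 3 ^ (64 * k ^ 2 - 2 * k) := by
        exact Nat.mul_le_mul_right _ (h1.trans (Nat.pow_le_pow_right (by norm_num) h2))
    _ = (2 * 3 ^ 3) ^ (18 * k ^ 2) * 3 ^ (r + 1) := by
        rw [hr, pow_add, pow_mul 3 3, mul_pow]; ring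
    _ < (4 ^ 3) ^ (18 * k ^ 2) * 4 ^ (r + 1) := by
        refine Nat.mul_lt_mul_of_le_of_lt (Nat.pow_le_pow_left (by norm_num) _)
          (Nat.pow_lt_pow_left (by norm_num) (by omega)) (by positivity)
    _ = _ := by rw [hr, pow_add 4 (3 * (18 * k ^ 2)), pow_mul 4 3]

open Classical in
/-- Halfspace containers: for linear forms on `ℝ^k` attached to the points of `V`, there are few
subsets of `V` such that every open halfspace is contained in one of them that exceeds the closed
halfspace by at most a quarter of `V`. -/
theorem exists_containers {β : Type} {k ℓ : ℕ} (hk : 1 ≤ k) (hℓ : k ≤ 2 ^ ℓ) (hℓk : ℓ ≤ k)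
    (V : Finset β) (hV : V.Nonempty) (φ : β → Fin k → ℝ) :
    ∃ 𝒞 : (Fin ((14 + 4 * ℓ) * k) → Bool) → Finset β, ∀ w : Fin k → ℝ, ∃ i,
      (∀ v ∈ V, φ v ⬝ᵥ w < 0 → v ∈ 𝒞 i) ∧
      4 * (𝒞 i).card ≤ 4 * (V.filter fun v => φ v ⬝ᵥ w ≤ 0).card + V.card := by
  obtain ⟨hn1, hn2⟩ := container_numerics k ℓ hk hℓ hℓk
  set m := 64 * k ^ 2 with hmdef
  have hmk : 2 * k ≤ m := by nlinarith
  have hm0 : 0 < m := by omega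
  let κ := Fin k → (Fin m × Bool) × (Fin m × Bool)
  have hcardκ : Fintype.card κ = (m * 2) ^ (2 * k) := by
    simp only [κ, Fintype.card_fun, Fintype.card_prod, Fintype.card_fin, Fintype.card_bool]
    rw [pow_mul, sq]
  let g : (Fin m → {v // v ∈ V}) → Fin m × Bool → Fin k → ℝ :=
    fun s p => if p.2 then φ (s p.1) else -φ (s p.1)
  let R : κ → (Fin m → {v // v ∈ V}) → Finset {v // v ∈ V} := fun c s =>
    Finset.univ.filter fun v =>
      (∃ x ∈ decompCell (g s) c, φ v ⬝ᵥ x < 0) ∧ ∃ x ∈ decompCell (g s) c, 0 < φ v ⬝ᵥ x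
  let J : κ → Finset (Fin m) := fun c =>
    Finset.univ.image (fun t => (c t).1.1) ∪ Finset.univ.image (fun t => (c t).2.1)
  have : Nonempty {v // v ∈ V} := hV.to_subtype
  obtain ⟨s, hs⟩ := exists_sample hmk J
    (fun c => by
      refine (Finset.card_union_le _ _).trans ?_
      have h1 : ∀ f : Fin k → Fin m, (Finset.univ.image f).card ≤ k := fun f =>
        Finset.card_image_le.trans (by simp)
      have := h1 (fun t => (c t).1.1)
      have := h1 (fun t => (c t).2.1)
      omega) R
    (fun c s s' h => by
      have : decompCell (g s) c = decompCell (g s') c := by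
        refine decompCell_congr _ _ _ (fun t => ?_) (fun t => ?_)
        · simp only [g]; rw [h _ (by simp [J])]
        · simp only [g]; rw [h _ (by simp [J])]
      simp only [R, this])
    (by rw [hcardκ]; exact hn2)
  let 𝒞₀ : κ → Finset β := fun c => V.filter fun v => ∃ x ∈ decompCell (g s) c, φ v ⬝ᵥ x < 0
  have main : ∀ w : Fin k → ℝ, ∃ c : κ, (∀ v ∈ V, φ v ⬝ᵥ w < 0 → v ∈ 𝒞₀ c) ∧
      4 * (𝒞₀ c).card ≤ 4 * (V.filter fun v => φ v ⬝ᵥ w ≤ 0).card + V.card := by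
    intro w
    let S : Finset (Fin m × Bool) := Finset.univ.filter fun p => 0 ≤ g s p ⬝ᵥ w
    have hS : ∀ j, ∃ b, (j, b) ∈ S := by
      intro j
      rcases le_total 0 (φ (s j) ⬝ᵥ w) with h | h
      · exact ⟨true, by simpa [S, g] using h⟩
      · exact ⟨false, by simpa [S, g] using h⟩
    obtain ⟨c, hwc, hc⟩ := exists_decompCell S (by
      obtain ⟨b, hb⟩ := hS ⟨0, hm0⟩
      exact ⟨_, hb⟩) (g s) w (fun i hi => (Finset.mem_filter.1 hi).2)
    refine ⟨c, fun v hv hlt => Finset.mem_filter.2 ⟨hv, w, hwc, hlt⟩, ?_⟩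
    have hmiss : ∀ j, s j ∉ R c s := by
      intro j hj
      obtain ⟨-, ⟨x, hx, hx'⟩, y, hy, hy'⟩ := Finset.mem_filter.1 hj
      obtain ⟨b, hb⟩ := hS j
      have h1 := hc x hx _ hb
      have h2 := hc y hy _ hb
      cases b <;> simp [g] at h1 h2 <;> linarith
    have hRc := hs c hmiss
    rw [Fintype.card_coe] at hRc
    -- A container point that is positive at `w` changes sign on the cell, so it lies in the small
    -- region `R c s`.
    have hsub : 𝒞₀ c ⊆ (V.filter fun v => φ v ⬝ᵥ w ≤ 0) ∪
        (R c s).map (Function.Embedding.subtype _) := by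
      intro v hv
      obtain ⟨hvV, hx⟩ := Finset.mem_filter.1 hv
      rw [Finset.mem_union]
      rcases le_or_gt (φ v ⬝ᵥ w) 0 with h | h
      · exact Or.inl (Finset.mem_filter.2 ⟨hvV, h⟩)
      · refine Or.inr (Finset.mem_map.2 ⟨⟨v, hvV⟩, ?_, rfl⟩)
        exact Finset.mem_filter.2 ⟨Finset.mem_univ _, hx, w, hwc, h⟩
    have := (Finset.card_le_card hsub).trans (Finset.card_union_le _ _)
    rw [Finset.card_map] at this
    omega
  have hle : Fintype.card κ ≤ Fintype.card (Fin ((14 + 4 * ℓ) * k) → Bool) := by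
    rw [hcardκ]; simpa using hn1
  obtain ⟨e⟩ := Function.Embedding.nonempty_of_card_le hle
  have hκ : Nonempty κ := ⟨fun _ => ((⟨0, hm0⟩, true), (⟨0, hm0⟩, true))⟩
  refine ⟨𝒞₀ ∘ Function.invFun e, fun w => ?_⟩
  obtain ⟨c, hc⟩ := main w
  refine ⟨e c, ?_⟩
  simpa [Function.leftInverse_invFun e.injective c] using hc

/-! ### Protocols -/

theorem exists_alice_sends_bits {𝒳 𝒴 Z : Type} {b c : ℕ} (a : 𝒳 → Fin b → Bool)
    (Q : (Fin b → Bool) → Protocol 𝒳 𝒴 Z) (hQ : ∀ i, (Q i).cost ≤ c) :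
    ∃ P : Protocol 𝒳 𝒴 Z, P.cost ≤ b + c ∧ ∀ x y, P.eval x y = (Q (a x)).eval x y := by
  induction b with
  | zero => exact ⟨Q Fin.elim0, by simpa using hQ _, fun x y => by rw [Subsingleton.elim (a x)]⟩
  | succ b ih =>
    choose P hP hP' using fun β : Bool => ih (fun x => Fin.tail (a x)) (fun i => Q (Fin.cons β i))
      (fun i => hQ _)
    refine ⟨.alice (fun x => a x 0) (P false) (P true), ?_, fun x y => ?_⟩
    · have := hP false
      have := hP true
      simp only [Protocol.cost]
      omega
    · have h : ∀ β, a x 0 = β → (P β).eval x y = (Q (a x)).eval x y := by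
        rintro β rfl
        rw [hP', Fin.cons_self_tail]
      simp only [Protocol.eval]
      split_ifs with h0
      · exact h _ h0
      · exact h _ (by simpa using h0)

theorem exists_bob_sends_bits {𝒳 𝒴 Z : Type} {b c : ℕ} (a : 𝒴 → Fin b → Bool)
    (Q : (Fin b → Bool) → Protocol 𝒳 𝒴 Z) (hQ : ∀ i, (Q i).cost ≤ c) :
    ∃ P : Protocol 𝒳 𝒴 Z, P.cost ≤ b + c ∧ ∀ x y, P.eval x y = (Q (a y)).eval x y := by
  induction b with
  | zero => exact ⟨Q Fin.elim0, by simpa using hQ _, fun x y => by rw [Subsingleton.elim (a y)]⟩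
  | succ b ih =>
    choose P hP hP' using fun β : Bool => ih (fun x => Fin.tail (a x)) (fun i => Q (Fin.cons β i))
      (fun i => hQ _)
    refine ⟨.bob (fun y => a y 0) (P false) (P true), ?_, fun x y => ?_⟩
    · have := hP false
      have := hP true
      simp only [Protocol.cost]
      omega
    · have h : ∀ β, a y 0 = β → (P β).eval x y = (Q (a y)).eval x y := by
        rintro β rfl
        rw [hP', Fin.cons_self_tail]
      simp only [Protocol.eval]
      split_ifs with h0
      · exact h _ h0
      · exact h _ (by simpa using h0)

/-- Alice says whether some message `i` satisfies `p x i`, and if so, sends such a message. -/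
theorem exists_alice_sends {𝒳 𝒴 Z : Type} {b c : ℕ} (p : 𝒳 → (Fin b → Bool) → Prop)
    (Q : (Fin b → Bool) → Protocol 𝒳 𝒴 Z) (hQ : ∀ i, (Q i).cost ≤ b + 1 + c)
    (Q₀ : Protocol 𝒳 𝒴 Z) (hQ₀ : Q₀.cost ≤ b + 1 + c) :
    ∃ P : Protocol 𝒳 𝒴 Z, P.cost ≤ 2 * (b + 1) + c ∧
      ∀ x y, (∃ i, p x i ∧ P.eval x y = (Q i).eval x y) ∨
        (∀ i, ¬ p x i) ∧ P.eval x y = Q₀.eval x y := by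
  classical
  obtain ⟨P, hP, hP'⟩ := exists_alice_sends_bits
    (fun x => if h : ∃ i, p x i then h.choose else fun _ => false) Q hQ
  refine ⟨.alice (fun x => decide (∃ i, p x i)) Q₀ P, ?_, fun x y => ?_⟩
  · simp only [Protocol.cost]
    omega
  · by_cases h : ∃ i, p x i
    · refine Or.inl ⟨h.choose, h.choose_spec, ?_⟩
      simp [Protocol.eval, h, hP']
    · exact Or.inr ⟨by simpa using h, by simp [Protocol.eval, h]⟩

/-- Bob says whether some message `i` satisfies `p y i`, and if so, sends such a message. -/
theorem exists_bob_sends {𝒳 𝒴 Z : Type} {b c : ℕ} (p : 𝒴 → (Fin b → Bool) → Prop)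
    (Q : (Fin b → Bool) → Protocol 𝒳 𝒴 Z) (hQ : ∀ i, (Q i).cost ≤ c)
    (Q₀ : Protocol 𝒳 𝒴 Z) (hQ₀ : Q₀.cost ≤ c) :
    ∃ P : Protocol 𝒳 𝒴 Z, P.cost ≤ b + 1 + c ∧
      ∀ x y, (∃ i, p y i ∧ P.eval x y = (Q i).eval x y) ∨
        (∀ i, ¬ p y i) ∧ P.eval x y = Q₀.eval x y := by
  classical
  obtain ⟨P, hP, hP'⟩ := exists_bob_sends_bits
    (fun y => if h : ∃ i, p y i then h.choose else fun _ => false) Q hQ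
  refine ⟨.bob (fun y => decide (∃ i, p y i)) Q₀ P, ?_, fun x y => ?_⟩
  · simp only [Protocol.cost]
    omega
  · by_cases h : ∃ i, p y i
    · refine Or.inl ⟨h.choose, h.choose_spec, ?_⟩
      simp [Protocol.eval, h, hP']
    · exact Or.inr ⟨by simpa using h, by simp [Protocol.eval, h]⟩

theorem exists_detCC_eq {𝒳 𝒴 Z : Type} {f : 𝒳 → 𝒴 → Z} {K : ℕ}
    (h : ∃ P : Protocol 𝒳 𝒴 Z, P.cost ≤ K ∧ P.Computes f) :
    ∃ k : ℕ, detCC f = (k : ℕ∞) ∧ k ≤ K := by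
  obtain ⟨P, hP, hPf⟩ := h
  have hle : detCC f ≤ (K : ℕ∞) := (iInf₂_le P hPf).trans (by exact_mod_cast hP)
  obtain ⟨k, hk⟩ := ENat.ne_top_iff_exists.1 (ne_top_of_le_ne_top (ENat.natCast_ne_top K) hle)
  refine ⟨k, hk.symm, ?_⟩
  rw [← hk] at hle
  exact_mod_cast hle

/-! ### Deciding whether two sets with separable hulls are disjoint -/

/-- Containers for the affine halfspaces of `ℝ^d`. -/
theorem exists_affine_containers {d ℓ : ℕ} (hℓ : d + 1 ≤ 2 ^ ℓ) (hℓd : ℓ ≤ d + 1)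
    (V : Finset (EuclideanSpace ℝ (Fin d))) (hV : V.Nonempty) :
    ∃ 𝒞 : (Fin ((14 + 4 * ℓ) * (d + 1)) → Bool) → Finset (EuclideanSpace ℝ (Fin d)),
      ∀ (f : EuclideanSpace ℝ (Fin d) →ₗ[ℝ] ℝ) (u : ℝ), ∃ i,
        (∀ v ∈ V, f v < u → v ∈ 𝒞 i) ∧
        4 * (𝒞 i).card ≤ 4 * (V.filter fun v => f v ≤ u).card + V.card := by
  obtain ⟨𝒞, h𝒞⟩ := exists_containers (by omega) hℓ hℓd V hV
    -- Homogenisation: the extra coordinate 1 turns `f v - u` into a linear form on dimension d + 1.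
    (fun v => (Fin.cons 1 (fun t => v t) : Fin (d + 1) → ℝ))
  refine ⟨𝒞, fun f u => ?_⟩
  have hf : ∀ v : EuclideanSpace ℝ (Fin d), (Fin.cons 1 (fun t => v t) : Fin (d + 1) → ℝ) ⬝ᵥ
      Fin.cons (-u) (fun t => f (EuclideanSpace.single t 1)) = f v - u := by
    intro v
    have : f v = ∑ t, v t * f (EuclideanSpace.single t 1) := by
      conv_lhs => rw [← (EuclideanSpace.basisFun (Fin d) ℝ).sum_repr v]
      simp
    rw [this]
    simp [dotProduct, Fin.sum_univ_succ]
    ring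
  obtain ⟨i, hi⟩ := h𝒞 (Fin.cons (-u) fun t => f (EuclideanSpace.single t 1))
  refine ⟨i, ?_⟩
  simp only [hf, sub_neg, sub_nonpos] at hi
  convert hi

/-- The points of `V` in one of the two sets can be separated off by a container if the hulls of the
two sets are disjoint. -/
theorem exists_container_of_disjoint {d : ℕ} {κ : Type} {V : Finset (EuclideanSpace ℝ (Fin d))}
    {𝒞 : κ → Finset (EuclideanSpace ℝ (Fin d))}
    (h𝒞 : ∀ (f : EuclideanSpace ℝ (Fin d) →ₗ[ℝ] ℝ) (u : ℝ), ∃ i,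
        (∀ v ∈ V, f v < u → v ∈ 𝒞 i) ∧
        4 * (𝒞 i).card ≤ 4 * (V.filter fun v => f v ≤ u).card + V.card)
    (A B : Finset (EuclideanSpace ℝ (Fin d)))
    (h : Disjoint (convexHull ℝ (A : Set (EuclideanSpace ℝ (Fin d)))) (convexHull ℝ ↑B)) :
    (∃ i, 4 * (𝒞 i).card ≤ 3 * V.card ∧ ∀ v ∈ V, v ∈ A → v ∈ 𝒞 i) ∨
      ∃ i, 4 * (𝒞 i).card ≤ 3 * V.card ∧ ∀ v ∈ V, v ∈ B → v ∈ 𝒞 i := by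
  obtain ⟨f, u, v, hu, huv, hv⟩ := geometric_hahn_banach_compact_closed (convex_convexHull ℝ _)
    (A.finite_toSet.isCompact_convexHull ℝ) (convex_convexHull ℝ _)
    (B.finite_toSet.isClosed_convexHull ℝ) h
  obtain ⟨i, hi, hi'⟩ := h𝒞 f u
  obtain ⟨j, hj, hj'⟩ := h𝒞 (-f) (-v)
  -- Since `u < v`, the two closed halfspaces share no point, so one has at most half of `V`; its
  -- container adds at most a quarter.
  have hdisj : Disjoint (V.filter fun z => (f : _ →ₗ[ℝ] ℝ) z ≤ u)
      (V.filter fun z => (-(f : _ →ₗ[ℝ] ℝ)) z ≤ -v) := by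
    rw [Finset.disjoint_filter]
    intro z _ h1 h2
    simp at h1 h2
    linarith
  have hcard := Finset.card_le_card (Finset.union_subset (Finset.filter_subset
    (fun z => (f : _ →ₗ[ℝ] ℝ) z ≤ u) V) (Finset.filter_subset
    (fun z => (-(f : _ →ₗ[ℝ] ℝ)) z ≤ -v) V))
  rw [Finset.card_union_of_disjoint hdisj] at hcard
  by_cases hc : 4 * (𝒞 i).card ≤ 3 * V.card
  · exact Or.inl ⟨i, hc, fun z hz hzA => hi z hz (hu z (subset_convexHull ℝ _ hzA))⟩
  · refine Or.inr ⟨j, by omega, fun z hz hzB => hj z hz ?_⟩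
    simpa using hv z (subset_convexHull ℝ _ hzB)

open Classical in
-- The invariant is that all common points lie in `V`. A container holding one player's part of `V`
-- preserves it and shrinks `V` by 3/4, so `hV` leaves `V` empty after `T` rounds.
theorem exists_protocol_of_subset {𝒳 𝒴 Z : Type} {d ℓ : ℕ} (hℓ : d + 1 ≤ 2 ^ ℓ)
    (hℓd : ℓ ≤ d + 1) (A : 𝒳 → Finset (EuclideanSpace ℝ (Fin d)))
    (B : 𝒴 → Finset (EuclideanSpace ℝ (Fin d)))
    (hAB : ∀ x y, Disjoint (A x) (B y) →
      Disjoint (convexHull ℝ (A x : Set (EuclideanSpace ℝ (Fin d)))) (convexHull ℝ ↑(B y)))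
    (z₀ z₁ : Z) (T : ℕ) (V : Finset (EuclideanSpace ℝ (Fin d))) (hV : V.card * 3 ^ T < 4 ^ T) :
    ∃ P : Protocol 𝒳 𝒴 Z, P.cost ≤ T * (2 * ((14 + 4 * ℓ) * (d + 1) + 1)) ∧
      ∀ x y, (∀ v ∈ A x, v ∈ B y → v ∈ V) →
        P.eval x y = if Disjoint (A x) (B y) then z₀ else z₁ := by
  induction T generalizing V with
  | zero =>
    obtain rfl : V = ∅ := by simpa using hV
    refine ⟨.leaf z₀, by simp [Protocol.cost], fun x y h => ?_⟩
    rw [if_pos (Finset.disjoint_left.2 fun v h1 h2 => by simpa using h v h1 h2), Protocol.eval]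
  | succ T ih =>
    rcases V.eq_empty_or_nonempty with rfl | hne
    · refine ⟨.leaf z₀, by simp [Protocol.cost], fun x y h => ?_⟩
      rw [if_pos (Finset.disjoint_left.2 fun v h1 h2 => by simpa using h v h1 h2), Protocol.eval]
    have hcont := exists_affine_containers hℓ hℓd V hne
    set b := (14 + 4 * ℓ) * (d + 1)
    obtain ⟨𝒞, h𝒞⟩ := hcont
    have hQ : ∀ i, ∃ P : Protocol 𝒳 𝒴 Z, P.cost ≤ T * (2 * (b + 1)) ∧
        (4 * (𝒞 i).card ≤ 3 * V.card → ∀ x y, (∀ v ∈ A x, v ∈ B y → v ∈ 𝒞 i) →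
          P.eval x y = if Disjoint (A x) (B y) then z₀ else z₁) := by
      intro i
      by_cases hc : 4 * (𝒞 i).card ≤ 3 * V.card
      · obtain ⟨P, h1, h2⟩ := ih (𝒞 i) (by
          rw [pow_succ, pow_succ] at hV
          have := Nat.mul_le_mul_right (3 ^ T) hc
          linarith)
        exact ⟨P, h1, fun _ => h2⟩
      -- Oversized containers are never announced; their leaf is a dummy.
      · exact ⟨.leaf z₀, by simp [Protocol.cost], fun h => (hc h).elim⟩
    choose Q hQc hQe using hQ
    obtain ⟨P₁, hP₁, hP₁e⟩ := exists_bob_sends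
      (fun y i => 4 * (𝒞 i).card ≤ 3 * V.card ∧ ∀ v ∈ V, v ∈ B y → v ∈ 𝒞 i) Q hQc (.leaf z₁)
      (by simp [Protocol.cost])
    obtain ⟨P, hP, hPe⟩ := exists_alice_sends
      (fun x i => 4 * (𝒞 i).card ≤ 3 * V.card ∧ ∀ v ∈ V, v ∈ A x → v ∈ 𝒞 i) Q
      (fun i => (hQc i).trans (Nat.le_add_left _ _)) P₁ hP₁
    refine ⟨P, hP.trans <| le_of_eq (by ring), fun x y hxy => ?_⟩
    rcases hPe x y with ⟨i, ⟨hi, hi'⟩, he⟩ | ⟨hA, he⟩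
    · rw [he]
      exact hQe i hi x y fun v h1 h2 => hi' v (hxy v h1 h2) h1
    rw [he]
    rcases hP₁e x y with ⟨i, ⟨hi, hi'⟩, he⟩ | ⟨hB, he⟩
    · rw [he]
      exact hQe i hi x y fun v h1 h2 => hi' v (hxy v h1 h2) h2
    rw [he, Protocol.eval, if_neg]
    intro hd
    rcases exists_container_of_disjoint h𝒞 _ _ (hAB x y hd) with ⟨i, hi⟩ | ⟨i, hi⟩
    · exact hA i hi
    · exact hB i hi

/-! ### Candidate points -/

theorem exists_range_eq {α : Type} {m : ℕ} (t : Finset α) (ht : t.Nonempty) (hm : t.card ≤ m) :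
    ∃ f : Fin m → α, Set.range f = t := by
  obtain ⟨e⟩ := Function.Embedding.nonempty_of_card_le
    (show Fintype.card t ≤ Fintype.card (Fin m) by simpa using hm)
  have : Nonempty t := ht.to_subtype
  refine ⟨Subtype.val ∘ Function.invFun e, ?_⟩
  rw [Set.range_comp, (Function.invFun_surjective e.injective).range_eq]
  simp

theorem exists_tuple_of_mem_convexHull {d : ℕ} {U : Finset (EuclideanSpace ℝ (Fin d))}
    {X : Set (EuclideanSpace ℝ (Fin d))} (hX : X ⊆ U) {x : EuclideanSpace ℝ (Fin d)}
    (hx : x ∈ convexHull ℝ X) :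
    ∃ p : Fin (d + 1) → U, (Set.range fun t => (p t : EuclideanSpace ℝ (Fin d))) ⊆ X ∧
      x ∈ convexHull ℝ (Set.range fun t => (p t : EuclideanSpace ℝ (Fin d))) := by
  have hcard : (Caratheodory.minCardFinsetOfMemConvexHull hx).card ≤ d + 1 := by
    have := (Caratheodory.affineIndependent_minCardFinsetOfMemConvexHull hx).card_le_finrank_succ
    rw [Fintype.card_coe] at this
    refine this.trans (Nat.succ_le_succ ((Submodule.finrank_le _).trans (by simp)))
  obtain ⟨f, hf⟩ := exists_range_eq _ (Caratheodory.minCardFinsetOfMemConvexHull_nonempty hx) hcard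
  have hsub := Caratheodory.minCardFinsetOfMemConvexHull_subseteq hx
  have hmem := Caratheodory.mem_minCardFinsetOfMemConvexHull hx
  rw [← hf] at hsub hmem
  exact ⟨fun t => ⟨f t, hX (hsub ⟨t, rfl⟩)⟩, hsub, hmem⟩

theorem exists_candidates_convexHull {d : ℕ} (U : Finset (EuclideanSpace ℝ (Fin d))) :
    ∃ V : Finset (EuclideanSpace ℝ (Fin d)), V.card ≤ U.card ^ (2 * d + 2) ∧
      ∀ X Y : Set (EuclideanSpace ℝ (Fin d)), X ⊆ U → Y ⊆ U →
        (convexHull ℝ X ∩ convexHull ℝ Y).Nonempty →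
        ∃ v ∈ V, v ∈ convexHull ℝ X ∧ v ∈ convexHull ℝ Y := by
  classical
  let H : (Fin (d + 1) → U) → Set (EuclideanSpace ℝ (Fin d)) := fun p =>
    convexHull ℝ (Set.range fun t => (p t : EuclideanSpace ℝ (Fin d)))
  let pt : (Fin (d + 1) → U) × (Fin (d + 1) → U) → EuclideanSpace ℝ (Fin d) := fun p =>
    if h : (H p.1 ∩ H p.2).Nonempty then h.some else 0
  refine ⟨Finset.univ.image pt, ?_, ?_⟩
  · refine Finset.card_image_le.trans_eq ?_
    simp only [Finset.card_univ, Fintype.card_prod, Fintype.card_fun, Fintype.card_coe,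
      Fintype.card_fin]
    ring
  · rintro X Y hX hY ⟨x, hx, hy⟩
    obtain ⟨p, hp, hxp⟩ := exists_tuple_of_mem_convexHull hX hx
    obtain ⟨q, hq, hxq⟩ := exists_tuple_of_mem_convexHull hY hy
    have h : (H p ∩ H q).Nonempty := ⟨x, hxp, hxq⟩
    have hpt : pt (p, q) ∈ H p ∩ H q := by
      simp only [pt, dif_pos h]
      exact h.some_mem
    exact ⟨pt (p, q), Finset.mem_image_of_mem _ (Finset.mem_univ _),
      convexHull_mono hp hpt.1, convexHull_mono hq hpt.2⟩

/-- A point of a nonempty polyhedron at which as many constraints as possible are tight spans, with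
the solutions of those tight equations, an affine subspace inside the polyhedron. -/
theorem exists_tight_system {d : ℕ} (K : Finset (EuclideanSpace ℝ (Fin d) × ℝ))
    (hK : ∃ x, ∀ c ∈ K, inner ℝ c.1 x ≤ c.2) :
    ∃ S ⊆ K, (∃ x, ∀ c ∈ S, inner ℝ c.1 x = c.2) ∧
      ∀ z, (∀ c ∈ S, inner ℝ c.1 z = c.2) → ∀ c ∈ K, inner ℝ c.1 z ≤ c.2 := by
  classical
  let tight : EuclideanSpace ℝ (Fin d) → Finset (EuclideanSpace ℝ (Fin d) × ℝ) := fun x =>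
    K.filter fun c => inner ℝ c.1 x = c.2
  obtain ⟨x₀, hx₀⟩ := hK
  obtain ⟨S, hS, hmax⟩ := Finset.exists_max_image
    (K.powerset.filter fun S => ∃ x, (∀ c ∈ K, inner ℝ c.1 x ≤ c.2) ∧ tight x = S) Finset.card
    ⟨tight x₀, by
      simp only [Finset.mem_filter, Finset.mem_powerset]
      exact ⟨Finset.filter_subset _ _, x₀, hx₀, rfl⟩⟩
  simp only [Finset.mem_filter, Finset.mem_powerset] at hS hmax
  obtain ⟨hSK, x, hx, rfl⟩ := hS
  refine ⟨tight x, hSK, ⟨x, fun c hc => (Finset.mem_filter.1 hc).2⟩, fun z hz => ?_⟩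
  by_contra! hcon
  obtain ⟨c₁, hc₁, hc₁'⟩ := hcon
  obtain ⟨c₀, hc₀, hmin⟩ := Finset.exists_min_image (K.filter fun c => c.2 < inner ℝ c.1 z)
    (fun c => (c.2 - inner ℝ c.1 x) / (inner ℝ c.1 z - inner ℝ c.1 x))
    ⟨c₁, Finset.mem_filter.2 ⟨hc₁, hc₁'⟩⟩
  obtain ⟨hc₀K, hc₀z⟩ := Finset.mem_filter.1 hc₀
  -- The point at parameter `r` on the way from `x` to `z` is where the first constraint violated at
  -- `z` becomes tight. It is feasible and has one more tight constraint, contradicting maximality.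
  set r := (c₀.2 - inner ℝ c₀.1 x) / (inner ℝ c₀.1 z - inner ℝ c₀.1 x) with hr
  have hx0 := hx c₀ hc₀K
  have hr0 : 0 ≤ r := div_nonneg (by linarith) (by linarith)
  have hr1 : r ≤ 1 := (div_le_one (by linarith)).2 (by linarith)
  have hy : ∀ c : EuclideanSpace ℝ (Fin d) × ℝ,
      (inner ℝ c.1 (x + r • (z - x)) : ℝ) =
        inner ℝ c.1 x + r * (inner ℝ c.1 z - inner ℝ c.1 x) := by
    intro c
    rw [inner_add_right, inner_smul_right, inner_sub_right]
  have hyK : ∀ c ∈ K, (inner ℝ c.1 (x + r • (z - x)) : ℝ) ≤ c.2 := by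
    intro c hc
    rw [hy]
    have h1 := hx c hc
    rcases lt_or_ge c.2 (inner ℝ c.1 z) with h | h
    · have h2 := hmin c (Finset.mem_filter.2 ⟨hc, h⟩)
      rw [le_div_iff₀ (by linarith)] at h2
      linarith
    · nlinarith
  have hle := hmax (tight (x + r • (z - x))) ⟨Finset.filter_subset _ _, _, hyK, rfl⟩
  refine absurd (Finset.card_lt_card ?_) (not_lt.2 hle)
  refine Finset.ssubset_iff_subset_ne.2 ⟨fun c hc => ?_, fun heq => ?_⟩
  · refine Finset.mem_filter.2 ⟨hSK hc, ?_⟩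
    rw [hy, hz c hc, (Finset.mem_filter.1 hc).2]
    ring
  · have h0 : c₀ ∈ tight (x + r • (z - x)) := by
      refine Finset.mem_filter.2 ⟨hc₀K, ?_⟩
      rw [hy, hr, div_mul_cancel₀ _ (by linarith)]
      ring
    rw [← heq] at h0
    exact hc₀z.ne' (hz c₀ h0)

/-- The tight system is consistent, so equations whose normals form a basis of the span of all its
normals imply the rest. At most d constraints therefore determine the affine subspace, and one
solution per choice suffices; `none` fills unused slots. -/
theorem exists_candidates_polyhedron {d : ℕ} (W : Finset (EuclideanSpace ℝ (Fin d) × ℝ)) :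
    ∃ V : Finset (EuclideanSpace ℝ (Fin d)), V.card ≤ (W.card + 1) ^ d ∧
      ∀ K ⊆ W, (∃ x, ∀ c ∈ K, inner ℝ c.1 x ≤ c.2) → ∃ v ∈ V, ∀ c ∈ K, inner ℝ c.1 v ≤ c.2 := by
  classical
  let sol : (Fin d → Option W) → EuclideanSpace ℝ (Fin d) → Prop := fun p z =>
    ∀ t, ∀ c : W, p t = some c → inner ℝ c.1.1 z = c.1.2
  let pt : (Fin d → Option W) → EuclideanSpace ℝ (Fin d) := fun p =>
    if h : ∃ z, sol p z then h.choose else 0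
  refine ⟨Finset.univ.image pt, ?_, fun K hKW hK => ?_⟩
  · refine Finset.card_image_le.trans_eq ?_
    simp
  obtain ⟨S, hSK, ⟨x, hx⟩, hS⟩ := exists_tight_system K hK
  obtain ⟨b, hbS, hspan, hli⟩ := exists_linearIndependent ℝ
    (Prod.fst '' (S : Set (EuclideanSpace ℝ (Fin d) × ℝ)))
  have : Fintype b := ((S.finite_toSet.image _).subset hbS).fintype
  have hbcard : Fintype.card b ≤ d := by simpa using hli.fintype_card_le_finrank
  obtain ⟨e⟩ := Function.Embedding.nonempty_of_card_le
    (show Fintype.card b ≤ Fintype.card (Fin d) by simpa using hbcard)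
  choose c hcS hcb using fun a : b => hbS a.2
  let p : Fin d → Option W := fun t =>
    (Function.partialInv e t).map fun a => ⟨c a, hKW (hSK (hcS a))⟩
  have hp : ∀ z, sol p z ↔ ∀ a : b, inner ℝ (a : EuclideanSpace ℝ (Fin d)) z = (c a).2 := by
    intro z
    constructor
    · intro h a
      have := h (e a) ⟨c a, hKW (hSK (hcS a))⟩ (by
        simp [p, Function.partialInv_left e.injective])
      rwa [hcb a] at this
    · rintro h t w hw
      obtain ⟨a, -, rfl⟩ := Option.map_eq_some_iff.1 hw
      have := h a
      rwa [← hcb a] at this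
  have hsol : ∃ z, sol p z := ⟨x, (hp x).2 fun a => by rw [← hcb a]; exact hx _ (hcS a)⟩
  have hpt : sol p (pt p) := by
    simp only [pt, dif_pos hsol]
    exact hsol.choose_spec
  refine ⟨pt p, Finset.mem_image_of_mem _ (Finset.mem_univ _), hS _ fun s hs => ?_⟩
  -- Two solutions of the basis equations differ by a vector orthogonal to every normal in the
  -- system.
  have hker : Submodule.span ℝ b ≤
      LinearMap.ker ((innerₗ (EuclideanSpace ℝ (Fin d))) (pt p - x)) := by
    rw [Submodule.span_le]
    intro a ha
    rw [SetLike.mem_coe, LinearMap.mem_ker, innerₗ_apply_apply, real_inner_comm, inner_sub_right]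
    have h1 := (hp _).1 hpt ⟨a, ha⟩
    have h2 := hx _ (hcS ⟨a, ha⟩)
    rw [hcb] at h2
    simp only at h1 h2
    linarith
  have h := hker (hspan ▸ Submodule.subset_span ⟨s, hs, rfl⟩ : s.1 ∈ Submodule.span ℝ b)
  rw [LinearMap.mem_ker, innerₗ_apply_apply, real_inner_comm, inner_sub_right, hx s hs] at h
  linarith

/-! ### The upper bound -/

theorem natClog_two_le {n : ℕ} (hn : 1 ≤ n) :
    (Nat.clog 2 (n + 1) : ℝ) ≤ 3 * Real.log ((n : ℝ) + 1) := by
  have hpos : 1 ≤ Nat.clog 2 (n + 1) := Nat.clog_pos (by norm_num) (by omega)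
  have h1 : 2 ^ (Nat.clog 2 (n + 1) - 1) ≤ n + 1 :=
    (Nat.pow_pred_clog_lt_self (by norm_num) (by omega)).le
  obtain ⟨m, hm⟩ := Nat.exists_eq_add_of_le' hpos
  rw [hm, Nat.add_sub_cancel] at h1
  have h2 : (2 : ℝ) ^ m ≤ (n : ℝ) + 1 := by exact_mod_cast h1
  have h3 := Real.log_le_log (by positivity) h2
  rw [Real.log_pow] at h3
  have h4 : Real.log 2 ≤ Real.log ((n : ℝ) + 1) :=
    Real.log_le_log (by norm_num) (by have : (1 : ℝ) ≤ n := by exact_mod_cast hn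
                                      linarith)
  have h5 := Real.log_two_gt_d9
  rw [hm]
  push_cast
  nlinarith [(Nat.cast_nonneg m : (0 : ℝ) ≤ m)]

/-- The bound for sets whose hulls are disjoint as soon as the sets are. -/
theorem exists_detCC_le {𝒳 𝒴 Z : Type} {d n : ℕ} (hd : 1 ≤ d)
    (A : 𝒳 → Finset (EuclideanSpace ℝ (Fin d))) (B : 𝒴 → Finset (EuclideanSpace ℝ (Fin d)))
    (hAB : ∀ x y, Disjoint (A x) (B y) →
      Disjoint (convexHull ℝ (A x : Set (EuclideanSpace ℝ (Fin d)))) (convexHull ℝ ↑(B y)))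
    (V : Finset (EuclideanSpace ℝ (Fin d))) (hV : V.card ≤ (n + 1) ^ (2 * d + 2)) (hn : 1 ≤ n)
    (hAV : ∀ x, A x ⊆ V) (z₀ z₁ : Z) (f : 𝒳 → 𝒴 → Z)
    (hf₀ : ∀ x y, Disjoint (A x) (B y) → f x y = z₀)
    (hf₁ : ∀ x y, ¬ Disjoint (A x) (B y) → f x y = z₁) :
    ∃ k : ℕ, detCC f = (k : ℕ∞) ∧
      (k : ℝ) ≤ 10000 * (d : ℝ) ^ 2 * Real.log ((d : ℝ) + 1) * Real.log ((n : ℝ) + 1) := by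
  classical
  set L := Nat.clog 2 (n + 1) with hL
  set ℓ := Nat.clog 2 (d + 1) with hℓ
  have hLn : n + 1 ≤ 2 ^ L := Nat.le_pow_clog (by norm_num) _
  have hLpos : 0 < L := Nat.clog_pos (by norm_num) (by omega)
  have hℓd : d + 1 ≤ 2 ^ ℓ := Nat.le_pow_clog (by norm_num) _
  have hℓd' : ℓ ≤ d + 1 := (Nat.clog_le_iff_le_pow (by norm_num)).2 Nat.lt_two_pow_self.le
  -- Three rounds more than halve `V`, as 2·27 < 64, so three rounds per bit of the bound on the
  -- size of `V` suffice.
  have hVT : V.card * 3 ^ (3 * (L * (2 * d + 2))) < 4 ^ (3 * (L * (2 * d + 2))) := by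
    have h1 : V.card ≤ 2 ^ (L * (2 * d + 2)) := by
      rw [pow_mul]
      exact hV.trans (Nat.pow_le_pow_left hLn _)
    calc _ ≤ 2 ^ (L * (2 * d + 2)) * 3 ^ (3 * (L * (2 * d + 2))) := Nat.mul_le_mul_right _ h1
      _ = 54 ^ (L * (2 * d + 2)) := by rw [pow_mul 3 3, ← mul_pow]; norm_num
      _ < 64 ^ (L * (2 * d + 2)) := Nat.pow_lt_pow_left (by norm_num) (by positivity)
      _ = _ := by rw [pow_mul 4 3]; norm_num
  obtain ⟨P, hP, hPe⟩ := exists_protocol_of_subset hℓd hℓd' A B hAB z₀ z₁ _ V hVT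
  obtain ⟨k, hk, hkle⟩ := exists_detCC_eq (f := f) ⟨P, hP, fun x y => by
    rw [hPe x y fun v hv _ => hAV x hv]
    split_ifs with h
    · exact (hf₀ x y h).symm
    · exact (hf₁ x y h).symm⟩
  refine ⟨k, hk, ?_⟩
  have hL3 : (L : ℝ) ≤ 3 * Real.log ((n : ℝ) + 1) := natClog_two_le hn
  have hℓ3 : (ℓ : ℝ) ≤ 3 * Real.log ((d : ℝ) + 1) := natClog_two_le hd
  have hd1 : (1 : ℝ) ≤ d := by exact_mod_cast hd
  have hlogd : 1 ≤ 2 * Real.log ((d : ℝ) + 1) := by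
    have h := Real.log_le_log (by norm_num) (show (2 : ℝ) ≤ (d : ℝ) + 1 by linarith)
    have := Real.log_two_gt_d9
    linarith
  have hlogn : 0 ≤ Real.log ((n : ℝ) + 1) := Real.log_nonneg (by simp)
  set D := Real.log ((d : ℝ) + 1)
  set N := Real.log ((n : ℝ) + 1)
  have hkR : (k : ℝ) ≤
      3 * (L * (2 * d + 2)) * (2 * ((14 + 4 * ℓ) * (d + 1) + 1)) := by exact_mod_cast hkle
  have h1 : (3 * (L * (2 * d + 2)) : ℝ) ≤ 36 * d * N := by
    have : (L : ℝ) * (2 * d + 2) ≤ (3 * N) * (4 * d) := by gcongr; linarith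
    linarith
  have h2 : (2 * ((14 + 4 * ℓ) * (d + 1) + 1) : ℝ) ≤ 168 * d * D := by
    have h3 : (14 + 4 * (ℓ : ℝ)) * (d + 1) ≤ (40 * D) * (2 * d) := by
      gcongr <;> linarith
    have : 1 ≤ 2 * D * d := by nlinarith
    nlinarith
  calc (k : ℝ) ≤ _ := hkR
    _ ≤ (36 * d * N) * (168 * d * D) := by gcongr
    _ = 6048 * (d ^ 2 * D * N) := by ring
    _ ≤ 10000 * (d ^ 2 * D * N) := by
      have : 0 ≤ D := by linarith
      gcongr
      norm_num
    _ = _ := by ring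

theorem exists_detCC_le_of_subsingleton {𝒳 𝒴 Z : Type} [Inhabited 𝒳] [Inhabited 𝒴]
    [Subsingleton 𝒳] [Subsingleton 𝒴] (f : 𝒳 → 𝒴 → Z) {r : ℝ} (hr : 0 ≤ r) :
    ∃ k : ℕ, detCC f = (k : ℕ∞) ∧ (k : ℝ) ≤ r := by
  obtain ⟨k, hk, hk0⟩ := exists_detCC_eq (f := f) (K := 0)
    ⟨.leaf (f default default), le_rfl, fun x y => by
      rw [Protocol.eval, Subsingleton.elim x default, Subsingleton.elim y default]⟩
  obtain rfl : k = 0 := by omega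
  exact ⟨0, hk, by simpa using hr⟩

theorem exists_detCC_CSD_le {d : ℕ} (hd : 1 ≤ d) (U : Finset (EuclideanSpace ℝ (Fin d)))
    (hU : 1 ≤ U.card) :
    ∃ k : ℕ, detCC (CSD U) = (k : ℕ∞) ∧
      (k : ℝ) ≤ 10000 * (d : ℝ) ^ 2 * Real.log ((d : ℝ) + 1) * Real.log ((U.card : ℝ) + 1) := by
  classical
  obtain ⟨V, hVcard, hV⟩ := exists_candidates_convexHull U
  let H : Set U → Set (EuclideanSpace ℝ (Fin d)) := fun X =>
    convexHull ℝ ((fun u : U => (u : EuclideanSpace ℝ (Fin d))) '' X)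
  let A : Set U → Finset (EuclideanSpace ℝ (Fin d)) := fun X => V.filter fun v => v ∈ H X
  have hsub : ∀ X : Set U, (fun u : U => (u : EuclideanSpace ℝ (Fin d))) '' X ⊆ U := by
    rintro X _ ⟨u, -, rfl⟩
    exact u.2
  have hdisj : ∀ X Y : Set U, Disjoint (A X) (A Y) → Disjoint (H X) (H Y) := by
    intro X Y h
    rw [Set.disjoint_iff_inter_eq_empty, ← Set.not_nonempty_iff_eq_empty]
    intro hne
    obtain ⟨v, hv, hvX, hvY⟩ := hV _ _ (hsub X) (hsub Y) hne
    exact Finset.disjoint_left.1 h (Finset.mem_filter.2 ⟨hv, hvX⟩) (Finset.mem_filter.2 ⟨hv, hvY⟩)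
  -- Convexity of `H X` is what transfers disjointness from the original sets to the hulls of the
  -- candidates.
  have hAH : ∀ X, convexHull ℝ (A X : Set (EuclideanSpace ℝ (Fin d))) ⊆ H X := fun X =>
    convexHull_min (fun v hv => (Finset.mem_filter.1 hv).2) (convex_convexHull ℝ _)
  refine exists_detCC_le hd A A (fun X Y h => (hdisj X Y h).mono (hAH X) (hAH Y)) V
    (hVcard.trans (Nat.pow_le_pow_left (Nat.le_succ _) _)) hU (fun X => Finset.filter_subset _ _)
    true false _ (fun X Y h => ?_) (fun X Y h => ?_)
  · exact if_neg (Set.not_nonempty_iff_eq_empty.2 (hdisj X Y h).inter_eq)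
  · obtain ⟨v, hvX, hvY⟩ := Finset.not_disjoint_iff.1 h
    exact if_pos ⟨v, (Finset.mem_filter.1 hvX).2, (Finset.mem_filter.1 hvY).2⟩

theorem exists_detCC_LPFeas_le {d : ℕ} (hd : 1 ≤ d) (W : Finset (EuclideanSpace ℝ (Fin d) × ℝ))
    (hW : 1 ≤ W.card) :
    ∃ k : ℕ, detCC (LPFeas W) = (k : ℕ∞) ∧
      (k : ℝ) ≤ 10000 * (d : ℝ) ^ 2 * Real.log ((d : ℝ) + 1) * Real.log ((W.card : ℝ) + 1) := by
  classical
  obtain ⟨V, hVcard, hV⟩ := exists_candidates_polyhedron W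
  let H : Set W → Set (EuclideanSpace ℝ (Fin d)) := fun X => {x | ∀ c ∈ X, inner ℝ c.1.1 x ≤ c.1.2}
  let A : Set W → Finset (EuclideanSpace ℝ (Fin d)) := fun X => V.filter fun v => v ∈ H X
  have hdisj : ∀ X Y : Set W, Disjoint (A X) (A Y) → ∀ x, x ∈ H X → x ∉ H Y := by
    intro X Y h x hX hY
    obtain ⟨v, hv, hv'⟩ := hV (W.filter fun c => ∃ h : c ∈ W, (⟨c, h⟩ : W) ∈ X ∪ Y)
      (Finset.filter_subset _ _) ⟨x, fun c hc => by
        obtain ⟨-, hcW, hc | hc⟩ := Finset.mem_filter.1 hc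
        · exact hX _ hc
        · exact hY _ hc⟩
    have hmem : ∀ c ∈ X ∪ Y, inner ℝ c.1.1 v ≤ c.1.2 := fun c hc =>
      hv' c.1 (Finset.mem_filter.2 ⟨c.2, c.2, hc⟩)
    exact Finset.disjoint_left.1 h
      (Finset.mem_filter.2 ⟨hv, fun c hc => hmem c (Or.inl hc)⟩)
      (Finset.mem_filter.2 ⟨hv, fun c hc => hmem c (Or.inr hc)⟩)
  have hconv : ∀ X, Convex ℝ (H X) := by
    intro X x hx y hy a b ha hb hab c hc
    rw [inner_add_right, inner_smul_right, inner_smul_right]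
    calc _ ≤ a * c.1.2 + b * c.1.2 :=
          add_le_add (mul_le_mul_of_nonneg_left (hx c hc) ha)
            (mul_le_mul_of_nonneg_left (hy c hc) hb)
      _ = _ := by rw [← add_mul, hab, one_mul]
  have hAH : ∀ X, convexHull ℝ (A X : Set (EuclideanSpace ℝ (Fin d))) ⊆ H X := fun X =>
    convexHull_min (fun v hv => (Finset.mem_filter.1 hv).2) (hconv X)
  refine exists_detCC_le hd A A
    (fun X Y h => (Set.disjoint_left.2 (hdisj X Y h)).mono (hAH X) (hAH Y)) V
    (hVcard.trans (Nat.pow_le_pow_right (by omega) (by omega))) hW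
    (fun X => Finset.filter_subset _ _) false true _ (fun X Y h => ?_) (fun X Y h => ?_)
  · refine if_neg ?_
    rintro ⟨x, hx⟩
    exact hdisj X Y h x (fun c hc => hx c (Or.inl hc)) (fun c hc => hx c (Or.inr hc))
  · obtain ⟨v, hvX, hvY⟩ := Finset.not_disjoint_iff.1 h
    refine if_pos ⟨v, ?_⟩
    rintro c (hc | hc)
    · exact (Finset.mem_filter.1 hvX).2 c hc
    · exact (Finset.mem_filter.1 hvY).2 c hc

theorem theorem3 :
    ∃ C : ℝ, 0 < C ∧ ∀ d n : ℕ, 1 ≤ d →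
      (∀ U : Finset (EuclideanSpace ℝ (Fin d)), U.card = n →
        ∃ k : ℕ, detCC (CSD U) = (k : ℕ∞) ∧
          (k : ℝ) ≤ C * (d : ℝ) ^ 2 * Real.log ((d : ℝ) + 1) * Real.log ((n : ℝ) + 1)) ∧
      (∀ W : Finset (EuclideanSpace ℝ (Fin d) × ℝ), W.card = n →
        ∃ k : ℕ, detCC (LPFeas W) = (k : ℕ∞) ∧
          (k : ℝ) ≤ C * (d : ℝ) ^ 2 * Real.log ((d : ℝ) + 1) * Real.log ((n : ℝ) + 1)) := by
  refine ⟨10000, by norm_num, fun d n hd => ⟨?_, ?_⟩⟩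
  · rintro U rfl
    -- For n = 0 the bound is 0, so a protocol without communication is required; each player then
    -- has only one input.
    rcases Nat.eq_zero_or_pos U.card with h | h
    · obtain rfl := Finset.card_eq_zero.1 h
      exact exists_detCC_le_of_subsingleton _ (by simp)
    · exact exists_detCC_CSD_le hd U h
  · rintro W rfl
    rcases Nat.eq_zero_or_pos W.card with h | h
    · obtain rfl := Finset.card_eq_zero.1 h
      exact exists_detCC_le_of_subsingleton _ (by simp)
    · exact exists_detCC_LPFeas_le hd W h
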